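/- Let $e_0,\dots,e_{n-1}\in\mathbb Z^2$ (subscripts modulo $n$) be arranged in anticlockwise order around the origin, going round it once, such that the angle from each $e_i$ to $e_{i+1}$ lies strictly between $0$ and $\pi$ (so $n\ge 3$). Let $C_i$ be the closed cone between the rays through $e_i$ and $e_{i+1}$. By a piecewise linear map of the plane of order $n$ with rotation number $\frac1n$ we mean a map $f:\mathbb R^2\to\mathbb R^2$ such that, for some such $e_0,\dots,e_{n-1}$ and every $i$, the restriction of $f$ to $C_{i-1}$ is given by a matrix $A_i\in SL(2,\mathbb Z)$ with $A_ie_{i-1}=e_i$ and $A_ie_i=e_{i+1}$ (so $f(C_{i-1})=C_i$). A fundamental polygon is a star shaped polygon with such vertices $e_0,\dots,e_{n-1}$ for which moreover all triangles $0,e_i,e_{i+1}$ have area $\frac12$; it is a fundamental polygon of $f$ if $f$ and $e_0,\dots,e_{n-1}$ are related as above. Vertex insertion inserts the vertex $e_i+e_{i+1}$ between two successive vertices $e_i,e_{i+1}$ of a polygon. Vertex removal deletes a vertex $e_i$ which is a vertex of the convex hull of the polygon and for which the angle at the origin from $e_{i-1}$ through $e_i$ to $e_{i+1}$ is strictly less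 than $\pi$. The base maps are the linear maps $\alpha=\begin{pmatrix}-1&-1\\1&0\end{pmatrix}$ and $\beta=\begin{pmatrix}0&-1\\1&0\end{pmatrix}$, and, for each integer $m>1$, the map $\varphi_m$ with fundamental polygon $(1,0),(0,1),(-1,0),(m,-1)$. Theorem. (1) Up to a global linear conjugacy, every piecewise linear map of the plane of order $n$ with rotation number $\frac1n$ is obtained by repeated vertex insertion from $\alpha$, $\beta$ or $\varphi_m$ for some $m>1$. That is, for every such $f$ with vectors $e_0,\dots,e_{n-1}$ there is $g\in GL(2,\mathbb Q)$ with $\det g>0$ such that $ge_0,\dots,ge_{n-1}$ are the vertices of a fundamental polygon of $gfg^{-1}$, and this polygon is obtained from a fundamental polygon of a base map by finitely many (possibly zero) vertex insertions; if $e_0,\dots,e_{n-1}$ already form a fundamental polygon, then $g$ can be taken in $SL(2,\mathbb Z)$. (2) Every fundamental polygon can be reduced by finitely many (possibly zero) vertex removals to the image, under some element of $SL(2,\mathbb Z)$, of a fundamental polygon of one of these base maps. -/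

import Mathlib

open scoped Matrix MatrixGroups

namespace CyclicPL

/-- Integer vectors of the plane. -/
abbrev Vec : Type := Fin 2 → ℤ

/-- The real plane (only its real vector space structure is used). -/
abbrev Plane : Type := Fin 2 → ℝ

/-- An integer vector, seen as a point of the real plane. -/
def toPlane (v : Vec) : Plane := fun k => (v k : ℝ)

/-- The determinant `det [a, b]` of the matrix with columns `a`, `b`. The triangle `0, a, b` is
positively oriented iff it is positive, and then its area is half of it. -/
def cross (a b : Vec) : ℤ := a 0 * b 1 - a 1 * b 0

/-- The closed cone spanned by the rays through `a` and `b`. -/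
def cone (a b : Vec) : Set Plane :=
  {x | ∃ s t : ℝ, 0 ≤ s ∧ 0 ≤ t ∧ x = s • toPlane a + t • toPlane b}

/-- The `n` vectors `e i`, subscripts modulo `n`, are arranged in anticlockwise order around the
origin, with an angle strictly between `0` and `π` from each one to the next:
turning anticlockwise from `e i` to `e (i + 1)` (the positive determinant) one meets no other
vector of the family, which says that the whole family goes round the origin exactly once.
(The vectors are then nonzero, on distinct rays, and `n` is at least `3`.) -/
structure IsAnticlockwise (n : ℕ) (e : ZMod n → Vec) : Prop where
  ne_zero : n ≠ 0
  cross_pos : ∀ i, 0 < cross (e i) (e (i + 1))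
  once : ∀ i j, toPlane (e j) ∈ cone (e i) (e (i + 1)) → j = i ∨ j = i + 1

/-- `f` is a piecewise linear map of the plane of order `n` and rotation number `1 / n`, with
vectors `e 0, …, e (n - 1)`: these are integer vectors in anticlockwise order, and on the closed
cone between `e (i - 1)` and `e i` the map `f` is given by a matrix of `SL(2, ℤ)` which sends
`e (i - 1)` to `e i` and `e i` to `e (i + 1)`, hence that cone to the next one. -/
structure IsCyclicMap (n : ℕ) (f : Plane → Plane) (e : ZMod n → Vec) : Prop where
  anticlockwise : IsAnticlockwise n e
  linear : ∀ i, ∃ A : SL(2, ℤ),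
    (∀ x ∈ cone (e (i - 1)) (e i), f x = (A : Matrix (Fin 2) (Fin 2) ℤ).map (Int.cast : ℤ → ℝ) *ᵥ x) ∧
    (A : Matrix (Fin 2) (Fin 2) ℤ) *ᵥ e (i - 1) = e i ∧
    (A : Matrix (Fin 2) (Fin 2) ℤ) *ᵥ e i = e (i + 1)

/-- A fundamental polygon: a polygon, star shaped about the origin, with integer vertices
`e 0, …, e (n - 1)` in anticlockwise order, such that each triangle `0, e i, e (i + 1)` has
area `1 / 2`. -/
structure IsFundamentalPolygon (n : ℕ) (e : ZMod n → Vec) : Prop where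
  anticlockwise : IsAnticlockwise n e
  cross_eq_one : ∀ i, cross (e i) (e (i + 1)) = 1

/-- `e` is a fundamental polygon of the map `f`. -/
def IsFundamentalPolygonOf (n : ℕ) (f : Plane → Plane) (e : ZMod n → Vec) : Prop :=
  IsCyclicMap n f e ∧ IsFundamentalPolygon n e

/-- The cyclic list of the vertices `e 0, …, e (n - 1)`. -/
def vertexCycle (n : ℕ) (e : ZMod n → Vec) : Cycle Vec :=
  ((List.range n).map fun i => e (i : ZMod n) : List Vec)

/-- `Q` arises from `P` by vertex insertion: the sum `a + b` of two successive vertices `a`, `b`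
is inserted between them. -/
def VertexInsertion (P Q : Cycle Vec) : Prop :=
  ∃ (a b : Vec) (l : List Vec),
    P = ((a :: b :: l : List Vec) : Cycle Vec) ∧ Q = ((a :: (a + b) :: b :: l : List Vec) : Cycle Vec)

/-- `Q` arises from `P` by vertex removal: the vertex `b`, with neighbours `a` and `c`, is a vertex
of the convex hull of `P`, the angle at the origin from `a` (through `b`) to `c` is strictly less
than `π` (that is, `det [a, c] > 0`), and `b` is removed. -/
def VertexRemoval (P Q : Cycle Vec) : Prop :=
  ∃ (a b c : Vec) (l : List Vec),
    P = ((a :: b :: c :: l : List Vec) : Cycle Vec) ∧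
    toPlane b ∈ (convexHull ℝ (toPlane '' {v | v ∈ P})).extremePoints ℝ ∧
    0 < cross a c ∧
    Q = ((a :: c :: l : List Vec) : Cycle Vec)

/-- The matrix `α`, of order 3. -/
def alpha : Matrix (Fin 2) (Fin 2) ℝ := !![-1, -1; 1, 0]

/-- The matrix `β`, of order 4. -/
def beta : Matrix (Fin 2) (Fin 2) ℝ := !![0, -1; 1, 0]

/-- The fundamental polygon that defines the map `φ_m`. -/
def phiPolygon (m : ℤ) : Cycle Vec :=
  ([![1, 0], ![0, 1], ![-1, 0], ![m, -1]] : List Vec)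

/-- `f` is one of the base maps `α`, `β` and `φ_m` with `m > 1`, and `e` is a fundamental polygon
of it. (The map `φ_m` is the one with fundamental polygon `phiPolygon m`.) -/
def IsBase (n : ℕ) (f : Plane → Plane) (e : ZMod n → Vec) : Prop :=
  IsFundamentalPolygonOf n f e ∧
    ((∀ x, f x = alpha *ᵥ x) ∨ (∀ x, f x = beta *ᵥ x) ∨
      ∃ m : ℤ, 1 < m ∧ vertexCycle n e = phiPolygon m)

/-- The real matrix of a rational matrix. -/
def toReal (g : Matrix (Fin 2) (Fin 2) ℚ) : Matrix (Fin 2) (Fin 2) ℝ :=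
  g.map (Rat.cast : ℚ → ℝ)

/-- The conjugate `g ∘ f ∘ g⁻¹` of `f` by a rational linear map `g`. -/
def conj (g : GL (Fin 2) ℚ) (f : Plane → Plane) : Plane → Plane := fun x =>
  toReal (g : Matrix (Fin 2) (Fin 2) ℚ) *ᵥ
    f (toReal ((g⁻¹ : GL (Fin 2) ℚ) : Matrix (Fin 2) (Fin 2) ℚ) *ᵥ x)

end CyclicPL

/-!
For a fundamental polygon, `e (i - 1) + e (i + 1) = k i • e i` with an integer
`k i = cross (e (i - 1)) (e (i + 1))`. A vertex removal at a vertex of the convex hull is possible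
only if `k i = 1`, and then it undoes a vertex insertion; so it suffices to find, in every
fundamental polygon which is not yet a base polygon, a vertex of the convex hull with `k i = 1`
(`IsFundamentalPolygon.exists_isRemovable_or`). The polygon that remains after its removal is
again fundamental (`IsFundamentalPolygon.exists_removal`), and induction on the number of vertices
proves both parts at once (`IsFundamentalPolygon.exists_reduction`).

A vertex `b` of the convex hull at which a functional `L` has a positive maximum has `k ≤ 1`, since
the neighbours of `b` have `L`-values that sum to `k * L b`, and `k = 2` would make `b` their
midpoint. Let `M` be the maximum of `cross (e p) (e q)` over all pairs of vertices.
* If `M = 1`, then all `k i` are in `{-1, 0, 1}`. A vertex with `k = 1` is a vertex of the convex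
  hull, and if all `k i` are `-1`, the sequence has period `3` and the polygon is the triangle
  of `α`.
* If `M ≥ 2`, take for `b` a vertex of the convex hull with `cross (e p) b = M`. Its `k` is not
  negative, as otherwise the vertex after `b` would have a determinant below `-M` with `e p`.
* In both cases there may remain a vertex with `k = 0`: its neighbours are opposite. If the polygon
  has at least five vertices, the other side of the line through them has at least two vertices,
  and a hull vertex farthest from the line has `k > 0`, hence `k = 1`. If it has four, it is
  equivalent to `(1, 0), (0, 1), (-1, 0), (m, -1)` with `m ≥ 0`: the polygon of `β` or `φ_m`, or one
  with a removable vertex if `m = 1`.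

For a general cyclic map, `cross (e i) (e (i + 1))` does not depend on `i`, and by the
Cayley-Hamilton theorem every `e i` is an integer combination of `e 0` and `e 1`; the coordinates
in this basis form a fundamental polygon (`IsCyclicMap.exists_fundamentalPolygon`).
-/

namespace CyclicPL

/-! ### Determinants, cones and integer linear maps -/

theorem cross_swap (a b : Vec) : cross b a = -cross a b := by
  simp only [cross]; ring

@[simp] theorem cross_self (a : Vec) : cross a a = 0 := by
  simp only [cross]; ring

@[simp] theorem cross_add_left (a b c : Vec) : cross (a + b) c = cross a c + cross b c := by
  simp only [cross, Pi.add_apply]; ring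

@[simp] theorem cross_add_right (a b c : Vec) : cross a (b + c) = cross a b + cross a c := by
  simp only [cross, Pi.add_apply]; ring

@[simp] theorem cross_neg_left (a b : Vec) : cross (-a) b = -cross a b := by
  simp only [cross, Pi.neg_apply]; ring

@[simp] theorem cross_neg_right (a b : Vec) : cross a (-b) = -cross a b := by
  simp only [cross, Pi.neg_apply]; ring

@[simp] theorem cross_smul_right (k : ℤ) (a b : Vec) : cross a (k • b) = k * cross a b := by
  simp only [cross, Pi.smul_apply, smul_eq_mul]; ring

/-- Cramer's rule in a unimodular basis. -/
theorem eq_cross_smul_add_cross_smul {a b : Vec} (h : cross a b = 1) (v : Vec) :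
    v = cross v b • a + cross a v • b := by
  simp only [cross] at h ⊢
  ext k
  fin_cases k <;> simp only [Pi.add_apply, Pi.smul_apply, smul_eq_mul, Fin.zero_eta, Fin.mk_one]
  · linear_combination (-v 0) * h
  · linear_combination (-v 1) * h

theorem vec_ext {v w : Vec} (h₀ : v 0 = w 0) (h₁ : v 1 = w 1) : v = w := by
  ext k; fin_cases k <;> assumption

theorem cross_mulVec (A : Matrix (Fin 2) (Fin 2) ℤ) (a b : Vec) :
    cross (A *ᵥ a) (A *ᵥ b) = A.det * cross a b := by
  simp only [cross, Matrix.mulVec, dotProduct, Fin.sum_univ_two, Matrix.det_fin_two]; ring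

theorem cross_mulVec_SL (A : SL(2, ℤ)) (a b : Vec) :
    cross ((A : Matrix (Fin 2) (Fin 2) ℤ) *ᵥ a) ((A : Matrix (Fin 2) (Fin 2) ℤ) *ᵥ b)
      = cross a b := by
  rw [cross_mulVec, A.det_coe, one_mul]

/-- `SL(2, ℤ)` acts transitively on positively oriented unimodular bases. -/
theorem exists_SL_mulVec_eq {a b c d : Vec} (h : cross a b = 1) (h' : cross c d = 1) :
    ∃ A : SL(2, ℤ), (A : Matrix (Fin 2) (Fin 2) ℤ) *ᵥ a = c ∧
      (A : Matrix (Fin 2) (Fin 2) ℤ) *ᵥ b = d := by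
  simp only [cross] at h h'
  refine ⟨⟨!![c 0 * b 1 - d 0 * a 1, d 0 * a 0 - c 0 * b 0;
    c 1 * b 1 - d 1 * a 1, d 1 * a 0 - c 1 * b 0], ?_⟩, vec_ext ?_ ?_, vec_ext ?_ ?_⟩
  · rw [Matrix.det_fin_two_of]
    linear_combination h' * (a 0 * b 1 - a 1 * b 0) + h
  all_goals simp [Matrix.mulVec, dotProduct, Fin.sum_univ_two]
  · linear_combination c 0 * h
  · linear_combination c 1 * h
  · linear_combination d 0 * h
  · linear_combination d 1 * h

theorem SL_inv_mulVec_mulVec (A : SL(2, ℤ)) (v : Vec) :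
    ((A⁻¹ : SL(2, ℤ)) : Matrix (Fin 2) (Fin 2) ℤ) *ᵥ
      ((A : Matrix (Fin 2) (Fin 2) ℤ) *ᵥ v) = v := by
  rw [Matrix.mulVec_mulVec, ← Matrix.SpecialLinearGroup.coe_mul, inv_mul_cancel,
    Matrix.SpecialLinearGroup.coe_one, Matrix.one_mulVec]

theorem toPlane_injective : Function.Injective toPlane := fun v w h => by
  ext k
  have := congrFun h k
  simp only [toPlane] at this
  exact_mod_cast this

theorem toPlane_mem_cone {a b v : Vec} (h : 0 < cross a b) :
    toPlane v ∈ cone a b ↔ 0 ≤ cross a v ∧ 0 ≤ cross v b := by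
  have hD : (0 : ℝ) < a 0 * b 1 - a 1 * b 0 := by
    simp only [cross] at h; exact_mod_cast h
  constructor
  · rintro ⟨s, t, hs, ht, hv⟩
    have h0 := congrFun hv 0
    have h1 := congrFun hv 1
    simp only [toPlane, Pi.add_apply, Pi.smul_apply, smul_eq_mul] at h0 h1
    have h2 : ((cross a v : ℤ) : ℝ) = t * (a 0 * b 1 - a 1 * b 0) := by
      simp only [cross]; push_cast; rw [h0, h1]; ring
    have h3 : ((cross v b : ℤ) : ℝ) = s * (a 0 * b 1 - a 1 * b 0) := by
      simp only [cross]; push_cast; rw [h0, h1]; ring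
    constructor
    · have : (0 : ℝ) ≤ (cross a v : ℤ) := h2 ▸ mul_nonneg ht hD.le
      exact_mod_cast this
    · have : (0 : ℝ) ≤ (cross v b : ℤ) := h3 ▸ mul_nonneg hs hD.le
      exact_mod_cast this
  · rintro ⟨h1, h2⟩
    refine ⟨(cross v b : ℤ) / (a 0 * b 1 - a 1 * b 0 : ℝ),
      (cross a v : ℤ) / (a 0 * b 1 - a 1 * b 0 : ℝ), div_nonneg (by exact_mod_cast h2) hD.le,
      div_nonneg (by exact_mod_cast h1) hD.le, ?_⟩
    ext k
    simp only [cross]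
    fin_cases k <;>
    · simp only [toPlane, Pi.add_apply, Pi.smul_apply, smul_eq_mul, Fin.zero_eta, Fin.mk_one]
      push_cast
      rw [div_mul_eq_mul_div, div_mul_eq_mul_div, ← add_div, eq_div_iff hD.ne']
      ring

/-! ### Fundamental polygons -/

section Polygon

variable {n : ℕ} {e : ZMod n → Vec}

theorem IsFundamentalPolygon.mem_of_cross_nonneg (h : IsFundamentalPolygon n e) {i j : ZMod n}
    (h₁ : 0 ≤ cross (e i) (e j)) (h₂ : 0 ≤ cross (e j) (e (i + 1))) : j = i ∨ j = i + 1 :=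
  h.anticlockwise.once i j ((toPlane_mem_cone (h.anticlockwise.cross_pos i)).2 ⟨h₁, h₂⟩)

/-- Fundamental polygons are described by determinants alone. -/
theorem isFundamentalPolygon_of_cross (hn : n ≠ 0) (h₁ : ∀ i, cross (e i) (e (i + 1)) = 1)
    (h₂ : ∀ i j, 0 ≤ cross (e i) (e j) → 0 ≤ cross (e j) (e (i + 1)) → j = i ∨ j = i + 1) :
    IsFundamentalPolygon n e :=
  ⟨⟨hn, fun i => by rw [h₁]; exact one_pos, fun i j hj =>
    have h := (toPlane_mem_cone (by rw [h₁]; exact one_pos)).1 hj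
    h₂ i j h.1 h.2⟩, h₁⟩

theorem IsFundamentalPolygon.shift (h : IsFundamentalPolygon n e) (k : ZMod n) :
    IsFundamentalPolygon n (fun i => e (i + k)) := by
  refine isFundamentalPolygon_of_cross h.anticlockwise.ne_zero (fun i => ?_) (fun i j h₁ h₂ => ?_)
  · rw [add_right_comm]; exact h.cross_eq_one _
  · rw [add_right_comm] at h₂
    rcases h.mem_of_cross_nonneg h₁ h₂ with h | h
    · left; exact add_right_cancel h
    · right; rw [add_right_comm] at h; exact add_right_cancel h

theorem IsFundamentalPolygon.mulVec (h : IsFundamentalPolygon n e) (A : SL(2, ℤ)) :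
    IsFundamentalPolygon n (fun i => (A : Matrix (Fin 2) (Fin 2) ℤ) *ᵥ e i) := by
  refine isFundamentalPolygon_of_cross h.anticlockwise.ne_zero (fun i => ?_) (fun i j => ?_)
  · rw [cross_mulVec_SL]; exact h.cross_eq_one i
  · simp only [cross_mulVec_SL]; exact h.mem_of_cross_nonneg

theorem IsFundamentalPolygon.three_le (h : IsFundamentalPolygon n e) : 3 ≤ n := by
  by_contra! hn
  have h0 := h.anticlockwise.ne_zero
  interval_cases n
  · exact h0 rfl
  · have h1 := h.cross_eq_one 0
    rw [show (0 + 1 : ZMod 1) = 0 from rfl, cross_self] at h1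
    exact absurd h1 (by norm_num)
  · have h1 := h.cross_eq_one 0
    have h2 := h.cross_eq_one 1
    rw [zero_add] at h1
    rw [show (1 + 1 : ZMod 2) = 0 from rfl, cross_swap, h1] at h2
    exact absurd h2 (by norm_num)

/-- Two consecutive unimodular triangles: `e (i - 1) + e (i + 1)` is an integer multiple of `e i`.
The multiplier is positive, zero or negative according as the angle from `e (i - 1)` to
`e (i + 1)` is less than, equal to or greater than `π`. -/
theorem IsFundamentalPolygon.succ_eq (h : IsFundamentalPolygon n e) (i : ZMod n) :
    e (i + 1) = cross (e (i - 1)) (e (i + 1)) • e i - e (i - 1) := by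
  have h1 := h.cross_eq_one (i - 1)
  rw [sub_add_cancel] at h1
  have h2 := eq_cross_smul_add_cross_smul h1 (e (i + 1))
  rw [cross_swap (e i), h.cross_eq_one] at h2
  conv_lhs => rw [h2]
  rw [neg_one_smul]; abel

theorem natCast_inj_of_lt {n a b : ℕ} (ha : a < n) (hb : b < n) :
    (a : ZMod n) = b ↔ a = b := by
  rw [ZMod.natCast_eq_natCast_iff', Nat.mod_eq_of_lt ha, Nat.mod_eq_of_lt hb]

/-- Removing a vertex which is the sum of its neighbours leaves a fundamental polygon; the indices
are such that the vertex `e 0` is removed. -/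
theorem IsFundamentalPolygon.remove_zero {N : ℕ} {e : ZMod (N + 2) → Vec}
    (h : IsFundamentalPolygon (N + 2) e) (h0 : e 0 = e (-1) + e 1) :
    IsFundamentalPolygon (N + 1) (fun i => e ((i.val : ZMod (N + 2)) + 1)) := by
  have hlast : ((N : ZMod (N + 2)) + 1) = -1 := by
    have : ((N + 2 : ℕ) : ZMod (N + 2)) = 0 := ZMod.natCast_self _
    push_cast at this
    linear_combination this
  have hcross : cross (e (-1)) (e 1) = 1 := by
    have h1 := h.cross_eq_one (-1)
    rwa [neg_add_cancel, h0, cross_add_right, cross_self, zero_add] at h1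
  have hinj : ∀ i j : ZMod (N + 1), ((j.val : ZMod (N + 2)) = i.val) → j = i := fun i j hij => by
    rw [natCast_inj_of_lt (by have := j.val_lt; omega) (by have := i.val_lt; omega)] at hij
    exact ZMod.val_injective _ hij
  have hcase : ∀ i : ZMod (N + 1), (i + 1).val = i.val + 1 ∨ (i.val = N ∧ i + 1 = 0) := fun i => by
    rcases Nat.lt_or_ge i.val N with hi | hi
    · left
      have h1 : (1 : ZMod (N + 1)).val = 1 := ZMod.val_one'' (by omega)
      rw [ZMod.val_add_of_lt (by omega), h1]
    · have hi : i.val = N := by have := i.val_lt; omega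
      refine Or.inr ⟨hi, ?_⟩
      rw [← ZMod.natCast_zmod_val i, hi]
      exact_mod_cast ZMod.natCast_self (N + 1)
  refine isFundamentalPolygon_of_cross (Nat.succ_ne_zero N) (fun i => ?_) (fun i j h₁ h₂ => ?_)
  · rcases hcase i with hi | ⟨hi, hi'⟩
    · rw [hi, Nat.cast_succ]; exact h.cross_eq_one _
    · rw [hi', hi, hlast, ZMod.val_zero, Nat.cast_zero, zero_add]; exact hcross
  · rcases hcase i with hi | ⟨hi, hi'⟩
    · rw [hi, Nat.cast_succ] at h₂
      rcases h.mem_of_cross_nonneg h₁ h₂ with h | h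
      · exact Or.inl (hinj _ _ (add_right_cancel h))
      · right
        apply hinj
        rw [hi, Nat.cast_succ]
        exact add_right_cancel h
    · rw [hi', ZMod.val_zero, Nat.cast_zero, zero_add] at h₂
      rw [hi, hlast] at h₁
      set v := e ((j.val : ZMod (N + 2)) + 1) with hv
      have key : (j.val : ZMod (N + 2)) + 1 = -1 ∨ (j.val : ZMod (N + 2)) + 1 = 0 ∨
          (j.val : ZMod (N + 2)) + 1 = 1 := by
        rcases le_total 0 (cross v (e 0)) with h3 | h3
        · rcases h.mem_of_cross_nonneg (i := -1) h₁ (by rwa [neg_add_cancel]) with h4 | h4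
          · exact Or.inl h4
          · right; left; rw [h4, neg_add_cancel]
        · rcases h.mem_of_cross_nonneg (i := 0) (j := (j.val : ZMod (N + 2)) + 1)
            (by rw [← hv, cross_swap]; omega) (by rwa [zero_add]) with h4 | h4
          · exact Or.inr (Or.inl h4)
          · right; right; rw [h4, zero_add]
      have hj := j.val_lt
      rcases key with h4 | h4 | h4
      · left
        apply hinj
        rw [hi]
        linear_combination h4 - hlast
      · exfalso
        have : ((j.val + 1 : ℕ) : ZMod (N + 2)) = ((0 : ℕ) : ZMod (N + 2)) := by
          push_cast; exact h4
        rw [natCast_inj_of_lt (by omega) (by omega)] at this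
        omega
      · right
        rw [hi']
        apply hinj
        rw [ZMod.val_zero, Nat.cast_zero]
        linear_combination h4

end Polygon

/-! ### Vertices of the convex hull -/

/-- The vector `v` is a vertex of the convex hull of the set `S` of integer vectors. -/
def IsHullVertex (S : Set Vec) (v : Vec) : Prop :=
  toPlane v ∈ (convexHull ℝ (toPlane '' S)).extremePoints ℝ

/-- A linear functional attains its maximum over a finite set at a vertex of the convex hull:
the face where it is maximal has an extreme point by the Krein-Milman lemma. -/
theorem exists_isHullVertex_cross_le {S : Set Vec} (hS : S.Finite) (hne : S.Nonempty) (w : Vec) :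
    ∃ b ∈ S, (∀ v ∈ S, cross w v ≤ cross w b) ∧ IsHullVertex S b := by
  let l : StrongDual ℝ Plane :=
    (w 0 : ℝ) • ContinuousLinearMap.proj (R := ℝ) 1 -
      (w 1 : ℝ) • ContinuousLinearMap.proj (R := ℝ) 0
  have hl : ∀ v : Vec, l (toPlane v) = (cross w v : ℤ) := fun v => by
    simp [l, cross, toPlane]
  set K := convexHull ℝ (toPlane '' S) with hK
  have hcomp : IsCompact K := (hS.image _).isCompact_convexHull ℝ
  obtain ⟨x, hx⟩ : K.Nonempty := (hne.image _).convexHull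
  have hexp : IsExposed ℝ K (l.toExposed K) := ContinuousLinearMap.toExposed.isExposed
  obtain ⟨z, hzK, hz⟩ := hcomp.exists_isMaxOn ⟨x, hx⟩ l.continuous.continuousOn
  obtain ⟨y, hy⟩ := (hexp.isCompact hcomp).extremePoints_nonempty ⟨z, hzK, hz⟩
  have hyK := hexp.isExtreme.extremePoints_subset_extremePoints hy
  obtain ⟨b, hb, rfl⟩ := extremePoints_convexHull_subset hyK
  refine ⟨b, hb, fun v hv => ?_, hyK⟩
  have := hy.1.2 (toPlane v) (subset_convexHull _ _ ⟨v, hv, rfl⟩)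
  rw [hl, hl] at this
  exact_mod_cast this

/-- A vertex of the convex hull is not the midpoint of two points of the set. -/
theorem IsHullVertex.ne_of_two_smul {S : Set Vec} {a b c : Vec} (h : IsHullVertex S b)
    (ha : a ∈ S) (hc : c ∈ S) (hac : a + c = (2 : ℤ) • b) : a = b := by
  refine toPlane_injective (h.2 (subset_convexHull _ _ ⟨a, ha, rfl⟩)
    (subset_convexHull _ _ ⟨c, hc, rfl⟩)
    ⟨1 / 2, 1 / 2, by norm_num, by norm_num, by norm_num, ?_⟩)
  ext k
  have := congrFun hac k
  simp only [Pi.add_apply, Pi.smul_apply, smul_eq_mul] at this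
  have h2 : (a k : ℝ) + c k = 2 * b k := by exact_mod_cast this
  simp only [toPlane, Pi.add_apply, Pi.smul_apply, smul_eq_mul]
  linarith

/-! ### Finding a removable vertex -/

section Polygon

variable {n : ℕ} {e : ZMod n → Vec}

/-- The vertex `e j` is the sum of its neighbours and a vertex of the convex hull. Removing it is
a vertex removal and undoes a vertex insertion. -/
def IsRemovable (e : ZMod n → Vec) (j : ZMod n) : Prop :=
  e j = e (j - 1) + e (j + 1) ∧ IsHullVertex (Set.range e) (e j)

theorem IsRemovable.of_shift {j k : ZMod n} (h : IsRemovable (fun i => e (i + k)) j) :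
    IsRemovable e (j + k) := by
  obtain ⟨h1, h2⟩ := h
  refine ⟨?_, ?_⟩
  · beta_reduce at h1
    rw [h1]; congr 2 <;> ring
  · convert h2 using 1
    exact ((Equiv.addRight k).surjective.range_comp e).symm

theorem IsFundamentalPolygon.cross_add_cross (h : IsFundamentalPolygon n e) (j : ZMod n) (w : Vec) :
    cross w (e (j - 1)) + cross w (e (j + 1)) =
      cross (e (j - 1)) (e (j + 1)) * cross w (e j) := by
  conv_lhs =>
    rw [h.succ_eq j, sub_eq_add_neg (_ • _), cross_add_right, cross_smul_right, cross_neg_right]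
  ring

/-- A vertex of the convex hull which maximises a functional is removable as soon as the angle
between its neighbours is less than `π`. -/
theorem IsFundamentalPolygon.isRemovable_of_max (h : IsFundamentalPolygon n e) {j : ZMod n}
    {w : Vec} (hv : IsHullVertex (Set.range e) (e j)) (hpos : 0 < cross w (e j))
    (hmax : ∀ i, cross w (e i) ≤ cross w (e j)) (hk : 0 < cross (e (j - 1)) (e (j + 1))) :
    IsRemovable e j := by
  have hsum := h.cross_add_cross j w
  have hs := h.succ_eq j
  have h1 := h.cross_eq_one (j - 1)
  rw [sub_add_cancel] at h1
  set k := cross (e (j - 1)) (e (j + 1))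
  have hk2 : k ≤ 2 := by
    have := hmax (j - 1)
    have := hmax (j + 1)
    by_contra! hk2
    nlinarith
  have hk' : k = 1 ∨ k = 2 := by omega
  rcases hk' with hk' | hk'
  · refine ⟨?_, hv⟩
    rw [hs, hk', one_smul]; abel
  · exfalso
    have := hv.ne_of_two_smul ⟨j - 1, rfl⟩ ⟨j + 1, rfl⟩ (by rw [hs, hk']; abel)
    rw [this, cross_self] at h1
    exact absurd h1 (by norm_num)

/-- A sum of neighbours is a vertex of the convex hull if the polygon lies in the two half planes
through it which are parallel to its neighbours. -/
theorem IsFundamentalPolygon.isRemovable_of_le_one (h : IsFundamentalPolygon n e) {j : ZMod n}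
    (hj : cross (e (j - 1)) (e (j + 1)) = 1) (h₁ : ∀ i, cross (e (j - 1)) (e i) ≤ 1)
    (h₂ : ∀ i, cross (e i) (e (j + 1)) ≤ 1) : IsRemovable e j := by
  have : NeZero n := ⟨h.anticlockwise.ne_zero⟩
  have hs : e j = e (j - 1) + e (j + 1) := by
    have := h.succ_eq j
    rw [hj, one_smul] at this
    rw [this]; abel
  refine ⟨hs, ?_⟩
  obtain ⟨_, ⟨i, rfl⟩, hmax, hv⟩ := exists_isHullVertex_cross_le (Set.finite_range e)
    (Set.range_nonempty e) (e (j - 1) - e (j + 1))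
  have hsub : ∀ v, cross (e (j - 1) - e (j + 1)) v =
      cross (e (j - 1)) v + cross v (e (j + 1)) := fun v => by
    rw [sub_eq_add_neg (e (j - 1)), cross_add_left, cross_neg_left, cross_swap v (e (j + 1)),
      neg_neg]
  have h3 := hmax _ ⟨j, rfl⟩
  rw [hsub, hsub] at h3
  have h4 : cross (e (j - 1)) (e j) = 1 := by
    rw [hs, cross_add_right, cross_self, hj, zero_add]
  rw [h4, h.cross_eq_one] at h3
  have h5 := h₁ i
  have h6 := h₂ i
  have h7 := eq_cross_smul_add_cross_smul hj (e i)
  rw [show cross (e i) (e (j + 1)) = 1 by omega, show cross (e (j - 1)) (e i) = 1 by omega,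
    one_smul, one_smul, ← hs] at h7
  rwa [← h7]

/-- If two vertices with a single vertex between them are opposite, and there are at least two
vertices on the other side of the line through them, then one of these is removable: a vertex of
the convex hull farthest from the line. -/
theorem IsFundamentalPolygon.exists_isRemovable_of_opposite (h : IsFundamentalPolygon n e)
    (hn : 5 ≤ n) {i : ZMod n} (hi : e (i + 1) = -e (i - 1)) : ∃ j, IsRemovable e j := by
  have : NeZero n := ⟨h.anticlockwise.ne_zero⟩
  have hne : ∀ m : ℕ, 0 < m → m < n → (m : ZMod n) ≠ 0 := fun m h0 hm hm' => by
    rw [← Nat.cast_zero, natCast_inj_of_lt hm (by omega)] at hm'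
    omega
  have h1 : cross (e (i + 1)) (e i) = -1 := by rw [cross_swap, h.cross_eq_one]
  have h2 : cross (e (i + 1)) (e (i - 1)) = 0 := by rw [hi, cross_neg_left, cross_self, neg_zero]
  have hout : ∀ j, j ≠ i - 1 → j ≠ i → j ≠ i + 1 → 0 < cross (e (i + 1)) (e j) := by
    intro j hj1 hj2 hj3
    by_contra! hj
    have hj' : 0 ≤ cross (e (i - 1)) (e j) := by
      rw [hi, cross_neg_left] at hj; omega
    rcases le_total 0 (cross (e i) (e j)) with h3 | h3
    · rcases h.mem_of_cross_nonneg h3 (by rw [cross_swap]; omega) with h4 | h4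
      exacts [hj2 h4, hj3 h4]
    · rcases h.mem_of_cross_nonneg hj' (by rw [sub_add_cancel, cross_swap]; omega) with h4 | h4
      exacts [hj1 h4, hj2 (by rw [h4, sub_add_cancel])]
  obtain ⟨_, ⟨j, rfl⟩, hmax, hv⟩ := exists_isHullVertex_cross_le (Set.finite_range e)
    (Set.range_nonempty e) (e (i + 1))
  have hpos : 0 < cross (e (i + 1)) (e j) := by
    refine lt_of_lt_of_le (hout (i + 2) ?_ ?_ ?_) (hmax _ ⟨i + 2, rfl⟩) <;> intro h3
    · exact hne 3 (by omega) (by omega) (by push_cast; linear_combination h3)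
    · exact hne 2 (by omega) (by omega) (by push_cast; linear_combination h3)
    · exact hne 1 (by omega) (by omega) (by push_cast; linear_combination h3)
  refine ⟨j, h.isRemovable_of_max hv hpos (fun m => hmax _ ⟨m, rfl⟩) ?_⟩
  have hj1 : j ≠ i - 1 := by rintro rfl; omega
  have hj2 : j ≠ i := by rintro rfl; omega
  have hj3 : j ≠ i + 1 := by rintro rfl; rw [cross_self] at hpos; omega
  have hsum := h.cross_add_cross j (e (i + 1))
  have hnn : ∀ m, m ≠ i → 0 ≤ cross (e (i + 1)) (e m) ∧
      (cross (e (i + 1)) (e m) = 0 → m = i - 1 ∨ m = i + 1) := fun m hm => by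
    by_cases hm1 : m = i - 1
    · rw [hm1, h2]; exact ⟨le_rfl, fun _ => Or.inl rfl⟩
    by_cases hm2 : m = i + 1
    · rw [hm2, cross_self]; exact ⟨le_rfl, fun _ => Or.inr rfl⟩
    have := hout m hm1 hm hm2
    exact ⟨this.le, fun h => by omega⟩
  have hl := hnn (j - 1) (fun h => hj3 (by linear_combination h))
  have hr := hnn (j + 1) (fun h => hj1 (by linear_combination h))
  have hor : 0 < cross (e (i + 1)) (e (j - 1)) + cross (e (i + 1)) (e (j + 1)) := by
    by_contra! hle
    rcases hl.2 (by omega) with h3 | h3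
    · exact hj2 (by linear_combination h3)
    rcases hr.2 (by omega) with h4 | h4
    · exact hne 4 (by omega) (by omega) (by push_cast; linear_combination h4 - h3)
    · exact hj2 (by linear_combination h4)
  rw [hsum] at hor
  exact pos_of_mul_pos_left hor hpos.le

/-- Either a vertex is removable, or the polygon is a triangle or a quadrangle with two opposite
vertices. To see this, consider a pair of vertices with maximal determinant `M`. -/
theorem IsFundamentalPolygon.exists_isRemovable_or (h : IsFundamentalPolygon n e) :
    (∃ j, IsRemovable e j) ∨ n = 3 ∨ (n = 4 ∧ ∃ i, e (i + 1) = -e (i - 1)) := by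
  have : NeZero n := ⟨h.anticlockwise.ne_zero⟩
  have hn := h.three_le
  have hzero : ∀ i, cross (e (i - 1)) (e (i + 1)) = 0 →
      (∃ j, IsRemovable e j) ∨ n = 3 ∨ (n = 4 ∧ ∃ i, e (i + 1) = -e (i - 1)) := fun i hi => by
    have hi' : e (i + 1) = -e (i - 1) := by rw [h.succ_eq i, hi, zero_smul, zero_sub]
    rcases Nat.lt_or_ge n 5 with h5 | h5
    · have : n = 3 ∨ n = 4 := by omega
      rcases this with h3 | h4
      exacts [Or.inr (Or.inl h3), Or.inr (Or.inr ⟨h4, i, hi'⟩)]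
    · exact Or.inl (h.exists_isRemovable_of_opposite h5 hi')
  obtain ⟨⟨p, q⟩, hpq⟩ := Finite.exists_max (fun x : ZMod n × ZMod n => cross (e x.1) (e x.2))
  have hM : ∀ i j, cross (e i) (e j) ≤ cross (e p) (e q) := fun i j => hpq (i, j)
  rcases lt_or_ge (cross (e p) (e q)) 2 with hM2 | hM2
  · have hle : ∀ i j, cross (e i) (e j) ≤ 1 := fun i j => by have := hM i j; omega
    by_cases h1 : ∃ j, cross (e (j - 1)) (e (j + 1)) = 1
    · obtain ⟨j, hj⟩ := h1
      exact Or.inl ⟨j, h.isRemovable_of_le_one hj (hle _) (fun i => hle i _)⟩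
    by_cases h0 : ∃ j, cross (e (j - 1)) (e (j + 1)) = 0
    · obtain ⟨j, hj⟩ := h0
      exact hzero j hj
    -- All multipliers are `-1`, so that the sequence `e` is periodic with period `3`.
    have hneg : ∀ j, e (j + 1) = -e j - e (j - 1) := fun j => by
      have h3 := hle (j - 1) (j + 1)
      have h4 := hle (j + 1) (j - 1)
      rw [cross_swap] at h4
      have h5 : cross (e (j - 1)) (e (j + 1)) ≠ 1 := fun h => h1 ⟨j, h⟩
      have h6 : cross (e (j - 1)) (e (j + 1)) ≠ 0 := fun h => h0 ⟨j, h⟩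
      have h7 := h.succ_eq j
      rwa [show cross (e (j - 1)) (e (j + 1)) = -1 by omega, neg_one_smul] at h7
    have h3 : e 3 = e 0 := by
      have h2 := hneg 1
      have h3 := hneg 2
      rw [show (2 : ZMod n) - 1 = 1 by ring, show (1 : ZMod n) + 1 = 2 by ring, sub_self] at *
      rw [show (2 : ZMod n) + 1 = 3 by ring] at h3
      rw [h3, h2]; abel
    right; left
    rcases h.mem_of_cross_nonneg (i := 0) (j := 3) (by rw [h3, cross_self])
      (by rw [h3, h.cross_eq_one]; norm_num) with h4 | h4
    · have : ((3 : ℕ) : ZMod n) = 0 := by exact_mod_cast h4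
      rw [ZMod.natCast_eq_zero_iff] at this
      have := Nat.le_of_dvd (by norm_num) this
      omega
    · have : ((2 : ℕ) : ZMod n) = 0 := by push_cast; linear_combination h4
      rw [ZMod.natCast_eq_zero_iff] at this
      have := Nat.le_of_dvd (by norm_num) this
      omega
  · obtain ⟨_, ⟨j, rfl⟩, hmax, hv⟩ := exists_isHullVertex_cross_le (Set.finite_range e)
      (Set.range_nonempty e) (e p)
    have hj : cross (e p) (e j) = cross (e p) (e q) := le_antisymm (hM p j) (hmax _ ⟨q, rfl⟩)
    rw [← hj] at hM hM2
    rcases lt_trichotomy (cross (e (j - 1)) (e (j + 1))) 0 with hk | hk | hk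
    · -- `e p` is not in the cone between `e (j - 1)` and `e j`, hence beyond `e (j - 1)`, and so
      -- `cross (e p) (e (j + 1))` is less than `-M`.
      exfalso
      have hsum := h.cross_add_cross j (e p)
      have h3 := hM (j + 1) p
      rw [cross_swap] at h3
      have h4 : 0 < cross (e p) (e (j - 1)) := by
        by_contra! h4
        rcases h.mem_of_cross_nonneg (i := j - 1) (j := p) (by rw [cross_swap]; omega)
          (by rw [sub_add_cancel]; omega) with h5 | h5
        · have h6 := h.cross_eq_one (j - 1)
          rw [sub_add_cancel, ← h5] at h6
          omega
        · rw [h5, sub_add_cancel, cross_self] at hM2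
          omega
      nlinarith
    · exact hzero j hk
    · exact Or.inl ⟨j, h.isRemovable_of_max hv (by omega) (fun m => hmax _ ⟨m, rfl⟩) hk⟩

end Polygon

/-! ### Cycles of vertices -/

section Cycle

variable {n : ℕ} {e : ZMod n → Vec}

/-- In the definition of `vertexCycle` the coercion is applied to the list of indices as a whole
(through the monad `List`); here it is applied to each index. -/
theorem vertexCycle_eq (e : ZMod n → Vec) :
    vertexCycle n e = (((List.range n).map fun i : ℕ => e (i : ZMod n) : List Vec) : Cycle Vec) := by
  simp only [vertexCycle, List.bind_eq_flatMap, List.pure_def, List.map_flatMap,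
    List.map_singleton]
  rw [List.map_eq_flatMap]

theorem mem_vertexCycle (hn : n ≠ 0) {v : Vec} : v ∈ vertexCycle n e ↔ v ∈ Set.range e := by
  have : NeZero n := ⟨hn⟩
  simp only [vertexCycle_eq, Cycle.mem_coe_iff, List.mem_map, List.mem_range, Set.mem_range]
  constructor
  · rintro ⟨i, -, rfl⟩
    exact ⟨i, rfl⟩
  · rintro ⟨i, rfl⟩
    exact ⟨i.val, i.val_lt, by rw [ZMod.natCast_zmod_val]⟩

theorem vertexCycle_shift (hn : n ≠ 0) (e : ZMod n → Vec) (k : ZMod n) :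
    vertexCycle n (fun i => e (i + k)) = vertexCycle n e := by
  have : NeZero n := ⟨hn⟩
  have h1 : ∀ e : ZMod n → Vec, vertexCycle n (fun i => e (i + 1)) = vertexCycle n e := by
    intro e
    obtain ⟨N, rfl⟩ := Nat.exists_eq_add_one_of_ne_zero hn
    have hN : ((N : ZMod (N + 1)) + 1) = 0 := by exact_mod_cast ZMod.natCast_self (N + 1)
    have hl : ((List.range (N + 1)).map fun i : ℕ => e ((i : ZMod (N + 1)) + 1)) =
        ((List.range N).map fun i : ℕ => e ((i : ZMod (N + 1)) + 1)) ++ [e 0] := by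
      rw [List.range_succ, List.map_append, List.map_singleton, hN]
    have hr : ((List.range (N + 1)).map fun i : ℕ => e (i : ZMod (N + 1))) =
        e 0 :: ((List.range N).map fun i : ℕ => e ((i : ZMod (N + 1)) + 1)) := by
      rw [List.range_succ_eq_map]
      simp [Function.comp_def]
    rw [vertexCycle_eq, vertexCycle_eq, hl, hr, Cycle.coe_eq_coe]
    exact List.isRotated_concat _ _
  rw [← ZMod.natCast_zmod_val k]
  induction k.val with
  | zero => simp
  | succ m ih =>
    rw [← ih, ← h1 (fun i => e (i + (m : ZMod n)))]
    congr 1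
    ext1 i
    push_cast
    rw [add_assoc, add_comm (1 : ZMod n)]

theorem vertexCycle_mulVec (A : Matrix (Fin 2) (Fin 2) ℤ) :
    vertexCycle n (fun i => A *ᵥ e i) = (vertexCycle n e).map (A *ᵥ ·) := by
  simp only [vertexCycle_eq, Cycle.map_coe, List.map_map, Function.comp_def]

theorem VertexInsertion.mulVec {P Q : Cycle Vec} (h : VertexInsertion P Q)
    (A : Matrix (Fin 2) (Fin 2) ℤ) : VertexInsertion (P.map (A *ᵥ ·)) (Q.map (A *ᵥ ·)) := by
  obtain ⟨a, b, l, rfl, rfl⟩ := h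
  refine ⟨A *ᵥ a, A *ᵥ b, l.map (A *ᵥ ·), by simp only [Cycle.map_coe, List.map_cons], ?_⟩
  simp only [Cycle.map_coe, List.map_cons, Matrix.mulVec_add]

/-- A removable vertex can be removed: the result is a fundamental polygon with one vertex less. -/
theorem IsFundamentalPolygon.exists_removal (h : IsFundamentalPolygon n e) (hn : 4 ≤ n)
    {j : ZMod n} (hj : IsRemovable e j) :
    ∃ e' : ZMod (n - 1) → Vec, IsFundamentalPolygon (n - 1) e' ∧
      VertexRemoval (vertexCycle n e) (vertexCycle (n - 1) e') ∧
      VertexInsertion (vertexCycle (n - 1) e') (vertexCycle n e) := by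
  obtain ⟨N, rfl⟩ : ∃ N, n = N + 3 := ⟨n - 3, by omega⟩
  change ∃ e' : ZMod (N + 2) → Vec, IsFundamentalPolygon (N + 2) e' ∧
      VertexRemoval (vertexCycle (N + 3) e) (vertexCycle (N + 2) e') ∧
      VertexInsertion (vertexCycle (N + 2) e') (vertexCycle (N + 3) e)
  have hrange : Set.range e = {v | v ∈ vertexCycle (N + 3) e} := by
    ext v; exact (mem_vertexCycle (Nat.succ_ne_zero _)).symm
  obtain ⟨hj, hv⟩ := hj
  rw [hrange] at hv
  rw [← vertexCycle_shift (Nat.succ_ne_zero _) e j] at hv ⊢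
  have hf := h.shift j
  set f : ZMod (N + 3) → Vec := fun i => e (i + j) with hfdef
  have hf0 : f 0 = f (-1) + f 1 := by
    simp only [hfdef]
    rw [zero_add, add_comm 1 j, neg_add_eq_sub, ← hj]
  have hv : toPlane (f 0) ∈
      (convexHull ℝ (toPlane '' {v | v ∈ vertexCycle (N + 3) f})).extremePoints ℝ := by
    rw [hfdef]; beta_reduce; rw [zero_add]; exact hv
  have hlast : ((N : ZMod (N + 3)) + 1 + 1) = -1 := by
    have : ((N + 3 : ℕ) : ZMod (N + 3)) = 0 := ZMod.natCast_self _
    push_cast at this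
    linear_combination this
  refine ⟨_, hf.remove_zero hf0, ?_⟩
  set L := (List.range N).map fun i : ℕ => f ((i : ZMod (N + 3)) + 1 + 1) with hL
  have hQ : vertexCycle (N + 2) (fun i => f ((i.val : ZMod (N + 3)) + 1)) =
      ((f (-1) :: f 1 :: L : List Vec) : Cycle Vec) := by
    have : ((List.range (N + 2)).map fun i : ℕ =>
        f ((((i : ZMod (N + 2)).val : ℕ) : ZMod (N + 3)) + 1)) = f 1 :: L ++ [f (-1)] := by
      rw [List.map_congr_left (g := fun i : ℕ => f ((i : ZMod (N + 3)) + 1)) (fun i hi => by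
        rw [ZMod.val_cast_of_lt (List.mem_range.1 hi)]), List.range_succ, List.map_append,
        List.range_succ_eq_map]
      simp [hL, hlast, Function.comp_def]
    rw [vertexCycle_eq, this, Cycle.coe_eq_coe]
    exact List.isRotated_concat _ _
  have hP : vertexCycle (N + 3) f = ((f (-1) :: f 0 :: f 1 :: L : List Vec) : Cycle Vec) := by
    have : ((List.range (N + 3)).map fun i : ℕ => f i) = f 0 :: f 1 :: L ++ [f (-1)] := by
      rw [List.range_succ, List.map_append, List.range_succ_eq_map, List.range_succ_eq_map]
      simp [hL, ← hlast, Function.comp_def, add_assoc, one_add_one_eq_two]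
    rw [vertexCycle_eq, this, Cycle.coe_eq_coe]
    exact List.isRotated_concat _ _
  refine ⟨⟨f (-1), f 0, f 1, L, hP, hv, ?_, hQ⟩, ⟨f (-1), f 1, L, hQ, ?_⟩⟩
  · have h1 := hf.cross_eq_one (-1)
    rw [neg_add_cancel, hf0, cross_add_right, cross_self, zero_add] at h1
    rw [h1]; exact one_pos
  · rw [hP, hf0]

end Cycle

/-! ### Cyclic maps and the base polygons -/

section Maps

variable {n : ℕ} {e : ZMod n → Vec} {f : Plane → Plane}

theorem toPlane_mulVec (A : Matrix (Fin 2) (Fin 2) ℤ) (v : Vec) :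
    toPlane (A *ᵥ v) = A.map (Int.cast : ℤ → ℝ) *ᵥ toPlane v := by
  ext k
  simp [toPlane, Matrix.mulVec, dotProduct, Fin.sum_univ_two]

theorem IsCyclicMap.apply_eq (h : IsCyclicMap n f e) (i : ZMod n) {s t : ℝ} (hs : 0 ≤ s)
    (ht : 0 ≤ t) : f (s • toPlane (e (i - 1)) + t • toPlane (e i)) =
      s • toPlane (e i) + t • toPlane (e (i + 1)) := by
  obtain ⟨A, hA, h1, h2⟩ := h.linear i
  rw [hA _ ⟨s, t, hs, ht, rfl⟩, Matrix.mulVec_add, Matrix.mulVec_smul, Matrix.mulVec_smul,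
    ← toPlane_mulVec, ← toPlane_mulVec, h1, h2]

/-- For a fundamental polygon the matrices `A i` exist automatically, as they send a basis of `ℤ²`
to a basis of `ℤ²`. -/
theorem IsFundamentalPolygon.isCyclicMap (h : IsFundamentalPolygon n e)
    (hf : ∀ (i : ZMod n) (s t : ℝ), 0 ≤ s → 0 ≤ t →
      f (s • toPlane (e (i - 1)) + t • toPlane (e i)) =
        s • toPlane (e i) + t • toPlane (e (i + 1))) : IsCyclicMap n f e := by
  refine ⟨h.anticlockwise, fun i => ?_⟩
  have h1 := h.cross_eq_one (i - 1)
  rw [sub_add_cancel] at h1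
  obtain ⟨A, hA1, hA2⟩ := exists_SL_mulVec_eq h1 (h.cross_eq_one i)
  refine ⟨A, ?_, hA1, hA2⟩
  rintro x ⟨s, t, hs, ht, rfl⟩
  rw [hf i s t hs ht, Matrix.mulVec_add, Matrix.mulVec_smul, Matrix.mulVec_smul,
    ← toPlane_mulVec, ← toPlane_mulVec, hA1, hA2]

/-- The cycle `P` is the image under `SL(2, ℤ)` of a fundamental polygon of a base map. -/
def IsBaseCycle (P : Cycle Vec) : Prop :=
  ∃ (n : ℕ) (f : Plane → Plane) (e : ZMod n → Vec) (γ : SL(2, ℤ)), IsBase n f e ∧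
    P = vertexCycle n (fun i => (γ : Matrix (Fin 2) (Fin 2) ℤ) *ᵥ e i)

theorem isBaseCycle_of_mulVec {γ : SL(2, ℤ)}
    (h : IsBase n f (fun i => (γ : Matrix (Fin 2) (Fin 2) ℤ) *ᵥ e i)) :
    IsBaseCycle (vertexCycle n e) := by
  refine ⟨n, f, _, γ⁻¹, h, ?_⟩
  simp only [SL_inv_mulVec_mulVec]

theorem IsFundamentalPolygon.isBaseCycle_of_three {e : ZMod 3 → Vec}
    (h : IsFundamentalPolygon 3 e) : IsBaseCycle (vertexCycle 3 e) := by
  obtain ⟨γ, h0, h1⟩ := exists_SL_mulVec_eq (c := ![1, 0]) (d := ![-1, 1]) (h.cross_eq_one 0)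
    (by simp [cross])
  have hf := h.mulVec γ
  refine isBaseCycle_of_mulVec (γ := γ) (f := (alpha *ᵥ ·)) ?_
  set f : ZMod 3 → Vec := fun i => (γ : Matrix (Fin 2) (Fin 2) ℤ) *ᵥ e i with hfdef
  have h0 : f 0 = ![1, 0] := h0
  have h1 : f 1 = ![-1, 1] := h1
  have h2 : f 2 = ![0, -1] := by
    have h3 := hf.succ_eq 1
    have h4 := hf.cross_eq_one 2
    rw [show (2 : ZMod 3) + 1 = 0 from rfl] at h4
    rw [show (1 : ZMod 3) + 1 = 2 from rfl, sub_self, cross_swap, h4, h0, h1] at h3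
    rw [h3]
    ext k; fin_cases k <;> simp
  have halpha : ∀ i, alpha *ᵥ toPlane (f i) = toPlane (f (i + 1)) := by
    intro i
    have hi : i = 0 ∨ i = 1 ∨ i = 2 := by revert i; decide
    rcases hi with rfl | rfl | rfl
    · rw [zero_add, h0, h1]
      ext k; fin_cases k <;> simp [alpha, toPlane, Matrix.mulVec, dotProduct]
    · rw [show (1 : ZMod 3) + 1 = 2 from rfl, h1, h2]
      ext k; fin_cases k <;> simp [alpha, toPlane, Matrix.mulVec, dotProduct]
    · rw [show (2 : ZMod 3) + 1 = 0 from rfl, h2, h0]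
      ext k; fin_cases k <;> simp [alpha, toPlane, Matrix.mulVec, dotProduct]
  refine ⟨⟨hf.isCyclicMap fun i s t _ _ => ?_, hf⟩, Or.inl fun x => rfl⟩
  rw [Matrix.mulVec_add, Matrix.mulVec_smul, Matrix.mulVec_smul, halpha, halpha, sub_add_cancel]

/-- The piecewise linear map with fundamental polygon `(1, 0), (0, 1), (-1, 0), (m, -1)`: the map
`φ_m` for `m > 1`, and `β` for `m = 0`. -/
noncomputable def phi (m : ℤ) (x : Plane) : Plane :=
  ![-x 1 - m * min (x 0 + m * min (x 1) 0) 0, x 0 + m * min (x 1) 0]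

theorem phi_zero (x : Plane) : phi 0 x = beta *ᵥ x := by
  ext k; fin_cases k <;> simp [phi, beta, Matrix.mulVec, dotProduct, Fin.sum_univ_two]

theorem IsFundamentalPolygon.isCyclicMap_phi {e : ZMod 4 → Vec} (h : IsFundamentalPolygon 4 e)
    {m : ℤ} (h0 : e 0 = ![1, 0]) (h1 : e 1 = ![0, 1]) (h2 : e 2 = ![-1, 0])
    (h3 : e 3 = ![m, -1]) : IsCyclicMap 4 (phi m) e := by
  refine h.isCyclicMap fun i s t hs ht => ?_
  have hi : i = 0 ∨ i = 1 ∨ i = 2 ∨ i = 3 := by revert i; decide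
  rcases hi with rfl | rfl | rfl | rfl
  · rw [show (0 : ZMod 4) - 1 = 3 from rfl, zero_add, h3, h0, h1]
    ext k; fin_cases k <;> simp [phi, toPlane, hs]
    · right; linarith
    · ring
  · rw [sub_self, show (1 : ZMod 4) + 1 = 2 from rfl, h0, h1, h2]
    ext k; fin_cases k <;> simp [phi, toPlane, hs, ht]
  · rw [show (2 : ZMod 4) - 1 = 1 from rfl, show (2 : ZMod 4) + 1 = 3 from rfl, h1, h2, h3]
    ext k; fin_cases k <;> simp [phi, toPlane, hs, ht]
    ring
  · rw [show (3 : ZMod 4) - 1 = 2 from rfl, show (3 : ZMod 4) + 1 = 0 from rfl, h2, h3, h0]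
    ext k; fin_cases k <;> simp [phi, toPlane, ht]
    · rw [show -s + t * m + -(m * t) = -s by ring, min_eq_left (by linarith)]; ring
    · ring

/-- A quadrangle with two opposite vertices is a base polygon, or a vertex is removable (the
quadrangle of `φ_m` with `m = ±1`). The sign of `m` depends on which of the opposite vertices comes
first. -/
theorem IsFundamentalPolygon.isBaseCycle_of_four {e : ZMod 4 → Vec}
    (h : IsFundamentalPolygon 4 e) (h2 : e 2 = -e 0) :
    (∃ j, IsRemovable e j) ∨ IsBaseCycle (vertexCycle 4 e) := by
  have hlast : ∀ {e : ZMod 4 → Vec}, IsFundamentalPolygon 4 e →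
      e 3 = cross (e 3) (e 1) • e 0 - e 1 := fun {e} h => by
    have h3 := h.succ_eq 0
    rw [zero_add, show (0 : ZMod 4) - 1 = 3 from rfl] at h3
    exact eq_sub_of_add_eq' (eq_sub_iff_add_eq.1 h3)
  -- By symmetry `m` is nonnegative.
  wlog hm : 0 ≤ cross (e 3) (e 1) generalizing e with H
  · have h4 := H (h.shift 2) (by
      change e 0 = -e 2
      rw [h2, neg_neg]) (by
      change 0 ≤ cross (e 1) (e 3)
      rw [cross_swap]; omega)
    rw [vertexCycle_shift (by norm_num)] at h4
    exact h4.imp_left fun ⟨j, hj⟩ => ⟨j + 2, hj.of_shift⟩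
  have h3 := hlast h
  obtain ⟨m, hm'⟩ : ∃ m, m = cross (e 3) (e 1) := ⟨_, rfl⟩
  rw [← hm'] at h3 hm
  have h01 := h.cross_eq_one 0
  rw [zero_add] at h01
  by_cases hm1 : m = 1
  · left
    refine ⟨0, h.isRemovable_of_le_one ?_ ?_ ?_⟩
    · rw [zero_add, show (0 : ZMod 4) - 1 = 3 from rfl, ← hm', hm1]
    all_goals
      rw [hm1, one_smul, sub_eq_add_neg] at h3
      intro i
      have hi : i = 0 ∨ i = 1 ∨ i = 2 ∨ i = 3 := by revert i; decide
      have h10 := cross_swap (e 0) (e 1)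
      simp only [zero_add, show (0 : ZMod 4) - 1 = 3 from rfl]
      rcases hi with rfl | rfl | rfl | rfl <;> simp [h3, h2, h10, h01]
  right
  obtain ⟨γ, g0, g1⟩ := exists_SL_mulVec_eq (c := ![1, 0]) (d := ![0, 1]) h01 (by simp [cross])
  have hf := h.mulVec γ
  refine isBaseCycle_of_mulVec (γ := γ) (f := phi m) ?_
  have g2 : (γ : Matrix (Fin 2) (Fin 2) ℤ) *ᵥ e 2 = ![-1, 0] := by
    rw [h2, Matrix.mulVec_neg, g0]; simp
  have g3 : (γ : Matrix (Fin 2) (Fin 2) ℤ) *ᵥ e 3 = ![m, -1] := by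
    rw [h3, Matrix.mulVec_sub, Matrix.mulVec_smul, g0, g1]; simp
  refine ⟨⟨hf.isCyclicMap_phi g0 g1 g2 g3, hf⟩, ?_⟩
  right
  by_cases hm0 : m = 0
  · left
    rw [hm0]; exact phi_zero
  · right
    refine ⟨m, by omega, ?_⟩
    rw [vertexCycle_eq, phiPolygon, ← g0, ← g1, ← g2, ← g3]
    rfl

/-- Every fundamental polygon is reduced to a base polygon by vertex removals each of which undoes
a vertex insertion. -/
theorem IsFundamentalPolygon.exists_reduction (h : IsFundamentalPolygon n e) :
    ∃ P, IsBaseCycle P ∧ Relation.ReflTransGen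
      (fun P Q => VertexRemoval P Q ∧ VertexInsertion Q P) (vertexCycle n e) P := by
  induction n using Nat.strong_induction_on with
  | _ n ih =>
  have hrem : 4 ≤ n → ∀ j, IsRemovable e j → ∃ P, IsBaseCycle P ∧ Relation.ReflTransGen
      (fun P Q => VertexRemoval P Q ∧ VertexInsertion Q P) (vertexCycle n e) P := fun hn j hj => by
    obtain ⟨e', h', hr, hi⟩ := h.exists_removal hn hj
    obtain ⟨P, hP, hstep⟩ := ih (n - 1) (by omega) h'
    exact ⟨P, hP, Relation.ReflTransGen.head ⟨hr, hi⟩ hstep⟩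
  by_cases hn3 : n = 3
  · subst hn3
    exact ⟨_, h.isBaseCycle_of_three, .refl⟩
  have hn4 : 4 ≤ n := by have := h.three_le; omega
  rcases h.exists_isRemovable_or with ⟨j, hj⟩ | h3 | ⟨rfl, i, hi⟩
  · exact hrem hn4 j hj
  · exact absurd h3 hn3
  · have h4 := (h.shift (i - 1)).isBaseCycle_of_four (by
      rw [zero_add, ← hi]; congr 1; ring)
    rw [vertexCycle_shift (by norm_num)] at h4
    rcases h4 with ⟨j, hj⟩ | h4
    · exact hrem hn4 _ hj.of_shift
    · exact ⟨_, h4, .refl⟩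

end Maps

/-! ### Conjugation to a fundamental polygon -/

section Conjugation

variable {n : ℕ} {e e' : ZMod n → Vec} {f : Plane → Plane}

/-- Conjugation by `g` moves the vectors of a cyclic map by `g`. -/
theorem IsCyclicMap.conj (h : IsCyclicMap n f e) {g : GL (Fin 2) ℚ}
    (he : ∀ i, (fun k => (e' i k : ℚ)) =
      (g : Matrix (Fin 2) (Fin 2) ℚ) *ᵥ (fun k => (e i k : ℚ)))
    (h' : IsFundamentalPolygon n e') : IsCyclicMap n (conj g f) e' := by
  have h1 : ∀ i, toPlane (e' i) = toReal (g : Matrix (Fin 2) (Fin 2) ℚ) *ᵥ toPlane (e i) := by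
    intro i
    ext k
    have := congrFun (he i) k
    simp only [Matrix.mulVec, dotProduct, Fin.sum_univ_two] at this
    simp only [toPlane, toReal, Matrix.mulVec, dotProduct, Fin.sum_univ_two, Matrix.map_apply]
    exact_mod_cast congrArg (Rat.cast : ℚ → ℝ) this
  have h2 : ∀ i, toReal ((g⁻¹ : GL (Fin 2) ℚ) : Matrix (Fin 2) (Fin 2) ℚ) *ᵥ toPlane (e' i) =
      toPlane (e i) := by
    intro i
    have h3 : toReal ((g⁻¹ : GL (Fin 2) ℚ) : Matrix (Fin 2) (Fin 2) ℚ) *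
        toReal (g : Matrix (Fin 2) (Fin 2) ℚ) = 1 := by
      have h4 : ((g⁻¹ : GL (Fin 2) ℚ) : Matrix (Fin 2) (Fin 2) ℚ) *
          (g : Matrix (Fin 2) (Fin 2) ℚ) = 1 := by
        rw [← Units.val_mul, inv_mul_cancel, Units.val_one]
      have h5 := congrArg (fun M => (Rat.castHom ℝ).mapMatrix M) h4
      simp only [map_mul, map_one] at h5
      exact h5
    rw [h1, Matrix.mulVec_mulVec, h3, Matrix.one_mulVec]
  refine h'.isCyclicMap fun i s t hs ht => ?_
  rw [CyclicPL.conj, Matrix.mulVec_add, Matrix.mulVec_smul, Matrix.mulVec_smul, h2, h2,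
    h.apply_eq i hs ht, Matrix.mulVec_add, Matrix.mulVec_smul, Matrix.mulVec_smul, ← h1, ← h1]

theorem IsCyclicMap.cross_eq (h : IsCyclicMap n f e) (i : ZMod n) :
    cross (e i) (e (i + 1)) = cross (e (i - 1)) (e i) := by
  obtain ⟨A, -, h1, h2⟩ := h.linear i
  conv_lhs => rw [← h2]
  nth_rw 1 [← h1]
  rw [cross_mulVec_SL]

/-- Cayley-Hamilton: the sum of the neighbours of `e i` is a multiple of `e i` by the trace of the
matrix on the cone before it, an integer. -/
theorem IsCyclicMap.exists_succ_eq (h : IsCyclicMap n f e) (i : ZMod n) :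
    ∃ k : ℤ, e (i + 1) = k • e i - e (i - 1) := by
  obtain ⟨A, -, h1, h2⟩ := h.linear i
  have hdet := A.det_coe
  rw [Matrix.det_fin_two] at hdet
  refine ⟨A 0 0 + A 1 1, ?_⟩
  rw [← h2, ← h1]
  apply vec_ext <;>
    simp only [Matrix.mulVec, dotProduct, Fin.sum_univ_two, Pi.sub_apply, Pi.smul_apply,
      smul_eq_mul]
  · linear_combination (-e (i - 1) 0) * hdet
  · linear_combination (-e (i - 1) 1) * hdet

/-- All vectors of a cyclic map are integer combinations of `e 0` and `e 1`. Their coordinates form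
a fundamental polygon, as all determinants are divided by that of `e 0` and `e 1`, the common value
of the determinants of successive vectors. -/
theorem IsCyclicMap.exists_fundamentalPolygon (h : IsCyclicMap n f e) :
    ∃ e' : ZMod n → Vec, IsFundamentalPolygon n e' ∧ ∀ i, e i = e' i 0 • e 0 + e' i 1 • e 1 := by
  have hne : NeZero n := ⟨h.anticlockwise.ne_zero⟩
  have hconst : ∀ i, cross (e i) (e (i + 1)) = cross (e 0) (e 1) := by
    have hm : ∀ m : ℕ, cross (e m) (e (m + 1)) = cross (e 0) (e 1) := fun m => by
      induction m with
      | zero => rw [Nat.cast_zero, zero_add]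
      | succ m ih => rw [Nat.cast_succ, h.cross_eq, add_sub_cancel_right, ih]
    intro i
    rw [← ZMod.natCast_zmod_val i]
    exact hm _
  have hcoord : ∀ i, ∃ v : Vec, e i = v 0 • e 0 + v 1 • e 1 := by
    have hm : ∀ m : ℕ, (∃ v : Vec, e m = v 0 • e 0 + v 1 • e 1) ∧
        ∃ w : Vec, e (m + 1) = w 0 • e 0 + w 1 • e 1 := fun m => by
      induction m with
      | zero => exact ⟨⟨![1, 0], by simp⟩, ⟨![0, 1], by simp⟩⟩
      | succ m ih =>
        obtain ⟨⟨v, hv⟩, ⟨w, hw⟩⟩ := ih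
        obtain ⟨k, hk⟩ := h.exists_succ_eq ((m : ZMod n) + 1)
        refine ⟨⟨w, by rw [Nat.cast_succ, hw]⟩, ⟨k • w - v, ?_⟩⟩
        rw [Nat.cast_succ, hk, add_sub_cancel_right, hw, hv]
        simp only [Pi.sub_apply, Pi.smul_apply, smul_eq_mul]
        module
    intro i
    rw [← ZMod.natCast_zmod_val i]
    exact (hm _).1
  choose e' he' using hcoord
  have hd : 0 < cross (e 0) (e 1) := by
    have := h.anticlockwise.cross_pos 0
    rwa [zero_add] at this
  have hcross : ∀ i j, cross (e i) (e j) = cross (e 0) (e 1) * cross (e' i) (e' j) := by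
    intro i j
    rw [he' i, he' j]
    simp only [cross, Pi.add_apply, Pi.smul_apply, smul_eq_mul]
    ring
  refine ⟨e', isFundamentalPolygon_of_cross hne.out (fun i => ?_) (fun i j h1 h2 => ?_), he'⟩
  · have := hconst i
    rw [hcross] at this
    exact (mul_eq_left₀ hd.ne').1 this
  · refine h.anticlockwise.once i j ((toPlane_mem_cone (h.anticlockwise.cross_pos i)).2 ⟨?_, ?_⟩)
    · rw [hcross]; exact mul_nonneg hd.le h1
    · rw [hcross]; exact mul_nonneg hd.le h2

/-- A rational linear map of positive determinant which takes the vectors of a cyclic map to the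
vertices of a fundamental polygon; the identity if they already are such vertices. -/
theorem IsCyclicMap.exists_GL (h : IsCyclicMap n f e) :
    ∃ (g : GL (Fin 2) ℚ) (e' : ZMod n → Vec), 0 < (g : Matrix (Fin 2) (Fin 2) ℚ).det ∧
      (IsFundamentalPolygon n e → g = 1) ∧
      (∀ i, (fun k => (e' i k : ℚ)) =
        (g : Matrix (Fin 2) (Fin 2) ℚ) *ᵥ (fun k => (e i k : ℚ))) ∧
      IsFundamentalPolygon n e' := by
  by_cases hf : IsFundamentalPolygon n e
  · exact ⟨1, e, by simp, fun _ => rfl, fun i => by simp, hf⟩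
  obtain ⟨e', hf', he'⟩ := h.exists_fundamentalPolygon
  have hd : 0 < cross (e 0) (e 1) := by
    have := h.anticlockwise.cross_pos 0
    rwa [zero_add] at this
  set G : Matrix (Fin 2) (Fin 2) ℚ := !![(e 0 0 : ℚ), e 1 0; e 0 1, e 1 1] with hG
  have hdet : 0 < G.det := by
    rw [hG, Matrix.det_fin_two_of]
    simp only [cross] at hd
    have hd' : (0 : ℚ) < e 0 0 * e 1 1 - e 0 1 * e 1 0 := by exact_mod_cast hd
    linarith
  have hunit : IsUnit G.det := hdet.ne'.isUnit
  refine ⟨(Matrix.GeneralLinearGroup.mkOfDetNeZero G hdet.ne')⁻¹, e', ?_,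
    fun h => absurd h hf, fun i => ?_, hf'⟩
  · rw [Matrix.coe_units_inv]
    change 0 < (G⁻¹).det
    rw [Matrix.det_nonsing_inv, Ring.inverse_eq_inv']
    exact inv_pos.2 hdet
  · rw [Matrix.coe_units_inv]
    change _ = G⁻¹ *ᵥ _
    have : (fun k => (e i k : ℚ)) = G *ᵥ (fun k => (e' i k : ℚ)) := by
      ext k
      have := congrFun (he' i) k
      simp only [Pi.add_apply, Pi.smul_apply, smul_eq_mul] at this
      rw [this]
      fin_cases k <;> simp [hG, Matrix.mulVec, dotProduct, Fin.sum_univ_two] <;> ring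
    rw [this, Matrix.mulVec_mulVec, Matrix.nonsing_inv_mul _ hunit, Matrix.one_mulVec]

end Conjugation

end CyclicPL

theorem theorem2 :
    (∀ (n : ℕ) (f : CyclicPL.Plane → CyclicPL.Plane) (e : ZMod n → CyclicPL.Vec),
      CyclicPL.IsCyclicMap n f e →
        ∃ (g : GL (Fin 2) ℚ) (e' : ZMod n → CyclicPL.Vec),
          0 < (g : Matrix (Fin 2) (Fin 2) ℚ).det ∧
          (CyclicPL.IsFundamentalPolygon n e →
            ∃ γ : SL(2, ℤ), (g : Matrix (Fin 2) (Fin 2) ℚ) =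
              (γ : Matrix (Fin 2) (Fin 2) ℤ).map (Int.cast : ℤ → ℚ)) ∧
          (∀ i, (fun k => (e' i k : ℚ)) =
            (g : Matrix (Fin 2) (Fin 2) ℚ) *ᵥ (fun k => (e i k : ℚ))) ∧
          CyclicPL.IsFundamentalPolygonOf n (CyclicPL.conj g f) e' ∧
          ∃ (n₀ : ℕ) (f₀ : CyclicPL.Plane → CyclicPL.Plane) (e₀ : ZMod n₀ → CyclicPL.Vec),
            CyclicPL.IsBase n₀ f₀ e₀ ∧
            Relation.ReflTransGen CyclicPL.VertexInsertion
              (CyclicPL.vertexCycle n₀ e₀) (CyclicPL.vertexCycle n e')) ∧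
    (∀ (n : ℕ) (e : ZMod n → CyclicPL.Vec),
      CyclicPL.IsFundamentalPolygon n e →
        ∃ (n₀ : ℕ) (f₀ : CyclicPL.Plane → CyclicPL.Plane) (e₀ : ZMod n₀ → CyclicPL.Vec)
          (γ : SL(2, ℤ)),
          CyclicPL.IsBase n₀ f₀ e₀ ∧
          Relation.ReflTransGen CyclicPL.VertexRemoval (CyclicPL.vertexCycle n e)
            (CyclicPL.vertexCycle n₀
              (fun i => (γ : Matrix (Fin 2) (Fin 2) ℤ) *ᵥ e₀ i))) := by

  refine ⟨fun n f e h => ?_, fun n e h => ?_⟩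
  · obtain ⟨g, e₁, hdet, hg, he₁, hf₁⟩ := h.exists_GL
    obtain ⟨_, ⟨n₀, f₀, e₀, γ, hbase, rfl⟩, hred⟩ := hf₁.exists_reduction
    let Γ : GL (Fin 2) ℚ := Matrix.SpecialLinearGroup.toGL
      (Matrix.SpecialLinearGroup.map (Int.castRingHom ℚ) γ⁻¹)
    have hΓ : (Γ : Matrix (Fin 2) (Fin 2) ℚ) =
      ((γ⁻¹ : SL(2, ℤ)) : Matrix (Fin 2) (Fin 2) ℤ).map (Int.cast : ℤ → ℚ) := rfl
    have hΓdet : (Γ : Matrix (Fin 2) (Fin 2) ℚ).det = 1 :=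
      (Matrix.SpecialLinearGroup.map (Int.castRingHom ℚ) γ⁻¹).det_coe
    have he' : ∀ i, (fun k => ((((γ⁻¹ : SL(2, ℤ)) : Matrix (Fin 2) (Fin 2) ℤ) *ᵥ e₁ i) k : ℚ)) =
        ((Γ * g : GL (Fin 2) ℚ) : Matrix (Fin 2) (Fin 2) ℚ) *ᵥ (fun k => (e i k : ℚ)) := fun i => by
      rw [Units.val_mul, ← Matrix.mulVec_mulVec, ← he₁, hΓ]
      ext k
      simp only [Matrix.mulVec, dotProduct, Fin.sum_univ_two, Matrix.map_apply]
      push_cast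
      rfl
    refine ⟨Γ * g, _, ?_, fun hf => ⟨γ⁻¹, ?_⟩, he', ⟨h.conj he' (hf₁.mulVec _), hf₁.mulVec _⟩,
      n₀, f₀, e₀, hbase, ?_⟩
    · rw [Units.val_mul, Matrix.det_mul, hΓdet, one_mul]
      exact hdet
    · rw [hg hf, mul_one, hΓ]
    · have hrev : Relation.ReflTransGen CyclicPL.VertexInsertion _ _ :=
        Relation.ReflTransGen.swap _ _
          (Relation.ReflTransGen.mono (fun P Q hPQ => hPQ.2) _ _ hred)
      have hins := Relation.ReflTransGen.lift (p := CyclicPL.VertexInsertion)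
        (fun P : Cycle CyclicPL.Vec => P.map (((γ⁻¹ : SL(2, ℤ)) : Matrix (Fin 2) (Fin 2) ℤ) *ᵥ ·))
        (fun P Q hPQ => CyclicPL.VertexInsertion.mulVec hPQ _) _ _ hrev
      rw [Function.onFun, ← CyclicPL.vertexCycle_mulVec, ← CyclicPL.vertexCycle_mulVec] at hins
      simpa only [CyclicPL.SL_inv_mulVec_mulVec] using hins
  · obtain ⟨_, ⟨n₀, f₀, e₀, γ, hbase, rfl⟩, hred⟩ := h.exists_reduction
    exact ⟨n₀, f₀, e₀, γ, hbase, Relation.ReflTransGen.mono (fun P Q hPQ => hPQ.1) _ _ hred⟩
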